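/- All graphs are finite and simple. For a graph $G$ and $S\subseteq V(G)$, let $B(S)$ be the set of vertices outside $S$ that have a neighbour in $S$, let $B_{i,j}(G)$ be the number of sets $S\subseteq V(G)$ with $|B(S)|=i$ and $|S|=j$, and let $B(G;x,y)=\sum_{S\subseteq V(G)}x^{|B(S)|}y^{|S|}$ be the boundary polynomial of $G$. Let $G_1,G_2$ be graphs of order at least $2$ without isolated vertices. Let $\sigma_B$ be the Liapunov number at the origin of the system $$\frac{dx}{dt}=\alpha x-y+B(G_1;x,y)-1,\qquad \frac{dy}{dt}=x+\alpha y+B(G_2;x,y)-1$$ for $\alpha=0$, that is, $\sigma_B=d'''(0)$ for the displacement function $d(s)=P(s)-s$ of the Poincaré (first return) map $P$ of the positive $x$-axis near the origin; equivalently, $d(s)=\frac{\sigma_B}{3!}s^3+o(s^3)$ as $s\to0^+$. Then $\sigma_B$ exists and $$\sigma_B=\frac{3\pi}{2}\Big(3B_{0,3}(G_2)+B_{1,2}(G_1)+B_{2,1}(G_2)+2B_{0,2}(G_1)B_{0,2}(G_2)+B_{1,1}(G_1)B_{0,2}(G_1)-B_{1,1}(G_2)B_{0,2}(G_2)\Big).$$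 Moreover: 1. if $G_2$ has no pendant vertices (vertices of degree $1$), then $\sigma_B\not<0$; 2. if $G_2$ has no connected component isomorphic to the path $P_2$ on two vertices, then $\sigma_B\not<0$; 3. in particular, if $G_2$ is a complete graph of order at least $3$, then $\sigma_B\not<0$. -/

import Mathlib

open Filter Topology Asymptotics

namespace SimpleGraph

open Classical in
/-- The boundary of a vertex set `S`: the vertices outside `S` that have a neighbour in `S`. -/
noncomputable def vertexBoundary {V : Type*} [Fintype V] (G : SimpleGraph V) (S : Finset V) :
    Finset V :=
  Finset.univ.filter fun v => v ∉ S ∧ ∃ u ∈ S, G.Adj u v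

open Classical in
/-- `B_{i,j}(G)`: the number of vertex sets `S` with `|B(S)| = i` and `|S| = j`. -/
noncomputable def boundaryCoeff {V : Type*} [Fintype V] (G : SimpleGraph V) (i j : ℕ) : ℕ :=
  (Finset.univ.filter fun S : Finset V => (G.vertexBoundary S).card = i ∧ S.card = j).card

/-- The boundary polynomial `B(G; x, y) = ∑_{S ⊆ V(G)} x ^ |B(S)| * y ^ |S|`, as a function of
real `x` and `y`. -/
noncomputable def boundaryPoly {V : Type*} [Fintype V] (G : SimpleGraph V) (x y : ℝ) : ℝ :=
  ∑ S : Finset V, x ^ (G.vertexBoundary S).card * y ^ S.card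

end SimpleGraph

/-- The planar vector field of the system
`x' = α x - y + B(G₁; x, y) - 1`, `y' = x + α y + B(G₂; x, y) - 1`. -/
noncomputable def boundaryField {V₁ V₂ : Type*} [Fintype V₁] [Fintype V₂]
    (G₁ : SimpleGraph V₁) (G₂ : SimpleGraph V₂) (α : ℝ) (z : ℝ × ℝ) : ℝ × ℝ :=
  (α * z.1 - z.2 + G₁.boundaryPoly z.1 z.2 - 1, z.1 + α * z.2 + G₂.boundaryPoly z.1 z.2 - 1)

/-- The trajectory of the autonomous planar vector field `X` that starts at `(s, 0)` meets the open
positive `x`-axis again, for the first time after time `0`, and does so at `(s', 0)`. -/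
def IsFirstReturn (X : ℝ × ℝ → ℝ × ℝ) (s s' : ℝ) : Prop :=
  0 < s' ∧ ∃ (T : ℝ) (γ : ℝ → ℝ × ℝ), 0 < T ∧
    IsIntegralCurveOn γ (fun _ => X) (Set.Icc 0 T) ∧ γ 0 = (s, 0) ∧ γ T = (s', 0) ∧
    ∀ t ∈ Set.Ioo 0 T, ¬ (0 < (γ t).1 ∧ (γ t).2 = 0)

/-- `P` is (the germ at `0⁺` of) the Poincaré map of `X` at the origin, on the positive `x`-axis:
for all small `s > 0`, the trajectory through `(s, 0)` returns, and its first return is uniquely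
determined to be `(P s, 0)`. -/
def IsPoincareMap (X : ℝ × ℝ → ℝ × ℝ) (P : ℝ → ℝ) : Prop :=
  ∀ᶠ s in 𝓝[>] (0 : ℝ), ∀ s' : ℝ, IsFirstReturn X s s' ↔ s' = P s

/-- `σ` is the Liapunov number of `X` at the weak focus at the origin: the third derivative at `0`
of the displacement function `d s = P s - s`, where `P` is the Poincaré map. At a weak focus
`d 0 = d' 0 = d'' 0 = 0`, so that `σ = d''' 0` is read off from the third order Taylor expansion
`d s = (σ / 3!) s ^ 3 + o(s ^ 3)`, as `s` tends to `0` from the right. -/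
def IsLiapunovNumber (X : ℝ × ℝ → ℝ × ℝ) (σ : ℝ) : Prop :=
  ∃ P : ℝ → ℝ, IsPoincareMap X P ∧
    (fun s : ℝ => (P s - s) - σ / 6 * s ^ 3) =o[𝓝[>] 0] fun s : ℝ => s ^ 3

/-- A vector field has at most one Liapunov number at the origin. -/
theorem IsLiapunovNumber.unique {X : ℝ × ℝ → ℝ × ℝ} {σ τ : ℝ}
    (hσ : IsLiapunovNumber X σ) (hτ : IsLiapunovNumber X τ) : σ = τ := by
  obtain ⟨P, hP, hPσ⟩ := hσ
  obtain ⟨Q, hQ, hQτ⟩ := hτ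
  have hPQ : ∀ᶠ s in 𝓝[>] (0 : ℝ), P s = Q s := by
    filter_upwards [hP, hQ] with s h1 h2
    exact (h2 (P s)).1 ((h1 (P s)).2 rfl)
  have h := hQτ.sub hPσ
  have h' : (fun s : ℝ => (σ - τ) / 6 * s ^ 3) =o[𝓝[>] 0] fun s : ℝ => s ^ 3 := by
    refine h.congr' ?_ EventuallyEq.rfl
    filter_upwards [hPQ] with s hs
    rw [hs]; ring
  have hT := h'.tendsto_div_nhds_zero
  have hc : Tendsto (fun _ : ℝ => (σ - τ) / 6) (𝓝[>] (0 : ℝ)) (𝓝 0) := by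
    refine hT.congr' ?_
    filter_upwards [self_mem_nhdsWithin] with s hs
    have : s ≠ 0 := ne_of_gt hs
    field_simp
  have := tendsto_nhds_unique hc tendsto_const_nhds
  linarith

/-! Blow up the origin by $(x,y)\mapsto(sx,sy)$: the orbit from $(s,0)$ becomes an orbit from
$(1,0)$ of the rotation field perturbed by $O(s)$. It stays within $O(s)$ of $(\cos t,\sin t)$ and
first returns at a time $T=2\pi+O(s)$ (`exists_first_return_perturbed_rotation`).

The return point $\rho$ is then found with a Liapunov function
$W=x^2+y^2+s\cdot\text{cubic}+s^2\cdot\text{quartic}$, chosen so that $\dot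
W=s^2c\,(x^2+y^2)^2+O(s^3)$. Integrating over one turn gives $W(T)-W(0)=2\pi c s^2+O(s^3)$, hence
$\rho=1+\pi c s^2+O(s^3)$ and $P(s)-s=\pi c s^3+O(s^4)$, so $\sigma=6\pi c$
(`isLiapunovNumber_of_expansion`).

For graphs without isolated vertices, $B(G;x,y)-1$ starts in degree two
(`SimpleGraph.boundaryPoly_mul`), so the general formula applies. Its only negative term is
$B_{1,1}(G_2)B_{0,2}(G_2)$, and each extra hypothesis makes one factor vanish. -/

/-! ### Solutions of weakly perturbed equations. -/

open Set Metric in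
/-- A Picard–Lindelöf solution with initial value at the centre of the ball stays in the ball. -/
theorem IsPicardLindelof.exists_hasDerivWithinAt_mem_closedBall {E : Type*} [NormedAddCommGroup E]
    [NormedSpace ℝ E] [CompleteSpace E] {f : ℝ → E → E} {tmin tmax : ℝ} {t₀ : Icc tmin tmax}
    {x₀ : E} {a L K : NNReal} (hf : IsPicardLindelof f t₀ x₀ a 0 L K) :
    ∃ v : ℝ → E, v t₀ = x₀ ∧ ∀ t ∈ Icc tmin tmax,
      HasDerivWithinAt v (f t (v t)) (Icc tmin tmax) t ∧ v t ∈ closedBall x₀ a := by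
  have hx : x₀ ∈ closedBall x₀ ((0 : NNReal) : ℝ) := mem_closedBall_self le_rfl
  obtain ⟨v, hv⟩ := ODE.FunSpace.exists_isFixedPt_next hf hx
  refine ⟨v.compProj, by rw [ODE.FunSpace.compProj_val, ← hv, ODE.FunSpace.next_apply₀],
    fun t ht => ⟨?_, v.compProj_mem_closedBall hf.mul_max_le⟩⟩
  apply ODE.hasDerivWithinAt_picard_Icc t₀.2 hf.continuousOn_uncurry
    v.continuous_compProj.continuousOn (fun _ _ => v.compProj_mem_closedBall hf.mul_max_le)
    x₀ ht |>.congr_of_mem _ ht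
  intro t' ht'
  nth_rw 1 [← hv]
  rw [ODE.FunSpace.compProj_of_mem ht', ODE.FunSpace.next_apply]

/-- A `C¹` map is Lipschitz on compact sets. -/
theorem ContDiff.exists_lipschitzOnWith_of_isCompact {E F : Type*} [NormedAddCommGroup E]
    [NormedSpace ℝ E] [NormedAddCommGroup F] [NormedSpace ℝ F] {f : E → F} (hf : ContDiff ℝ 1 f)
    {s : Set E} (hs : IsCompact s) : ∃ K, LipschitzOnWith K f s := by
  refine LocallyLipschitzOn.exists_lipschitzOnWith_of_compact hs ?_
  refine LocallyLipschitz.locallyLipschitzOn fun x => ?_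
  exact hf.contDiffAt.exists_lipschitzOnWith

open Set Metric in
/-- The equation `v' = s F(s, t, v)` with a small parameter `s` has solutions on any prescribed time
interval, and these move by `O(s)` only. -/
theorem exists_solution_of_small_parameter {E : Type*} [NormedAddCommGroup E] [NormedSpace ℝ E]
    [CompleteSpace E] [ProperSpace E] {F : ℝ × ℝ × E → E} (hF : ContDiff ℝ 1 F) (x₀ : E)
    {τ : ℝ} (hτ : 0 < τ) :
    ∃ M > 0, ∃ s₀ > 0, ∀ s ∈ Ioc 0 s₀, ∃ v : ℝ → E, v 0 = x₀ ∧ ∀ t ∈ Icc 0 τ,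
      HasDerivWithinAt v (s • F (s, t, v t)) (Icc 0 τ) t ∧ ‖v t - x₀‖ ≤ M * s := by
  have hC : IsCompact (Icc (0 : ℝ) 1 ×ˢ Icc (0 : ℝ) τ ×ˢ closedBall x₀ 1) :=
    isCompact_Icc.prod (isCompact_Icc.prod (isCompact_closedBall x₀ 1))
  obtain ⟨K, hK⟩ := hF.exists_lipschitzOnWith_of_isCompact hC
  obtain ⟨B, hB⟩ := hC.exists_bound_of_continuousOn hF.continuous.continuousOn
  set N : ℝ := |B| + 1 with hN
  have hN0 : 0 < N := by positivity
  have hM : 0 < N * τ := by positivity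
  -- A speed of at most `N * s` during time `τ` gives a drift of at most `N * τ * s`; the choice of
  -- `s₀` keeps this below 1, inside the ball where the bounds on `F` hold.
  refine ⟨N * τ, hM, min 1 (1 / (N * τ)), by positivity, fun s hs => ?_⟩
  have hs0 : 0 < s := hs.1
  have hs1 : s ≤ 1 := hs.2.trans (min_le_left _ _)
  have hsM : N * τ * s ≤ 1 := by
    have := hs.2.trans (min_le_right _ _)
    rw [le_div_iff₀ hM] at this
    linarith
  have hmem : ∀ t ∈ Icc (0 : ℝ) τ, ∀ x ∈ closedBall x₀ (N * τ * s),
      (s, t, x) ∈ Icc (0 : ℝ) 1 ×ˢ Icc (0 : ℝ) τ ×ˢ closedBall x₀ 1 := fun t ht x hx =>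
    ⟨⟨hs0.le, hs1⟩, ht, closedBall_subset_closedBall hsM hx⟩
  have hpl : IsPicardLindelof (fun t x => s • F (s, t, x)) (⟨0, le_rfl, hτ.le⟩ : Icc (0 : ℝ) τ) x₀
      ⟨N * τ * s, by positivity⟩ 0 ⟨N * s, by positivity⟩ (‖s‖₊ * K) := by
    refine ⟨fun t ht => ?_, fun x _ => ?_, fun t ht x hx => ?_, ?_⟩
    · refine LipschitzOnWith.of_dist_le_mul fun x hx y hy => ?_
      rw [dist_smul₀]
      have h := hK.dist_le_mul _ (hmem t ht x hx) _ (hmem t ht y hy)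
      have h2 : dist (s, t, x) (s, t, y) = dist x y := by simp [Prod.dist_eq]
      rw [h2] at h
      push_cast
      rw [mul_assoc]
      gcongr
    · have := hF.continuous
      fun_prop
    · have h := hB _ (hmem t ht x hx)
      have h3 : ‖F (s, t, x)‖ ≤ N := by linarith [le_abs_self B]
      show ‖s • F (s, t, x)‖ ≤ N * s
      rw [norm_smul, Real.norm_of_nonneg hs0.le, mul_comm]
      gcongr
    · show N * s * max (τ - 0) (0 - 0) ≤ N * τ * s - 0
      rw [sub_zero, sub_zero, sub_zero, max_eq_left hτ.le]
      exact le_of_eq (by ring)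
  obtain ⟨v, hv0, hv⟩ := hpl.exists_hasDerivWithinAt_mem_closedBall
  refine ⟨v, hv0, fun t ht => ⟨(hv t ht).1, ?_⟩⟩
  have := (hv t ht).2
  rwa [mem_closedBall, dist_eq_norm] at this

open Set in
/-- Perturbations of size `s` of the planar rotation have solutions on any prescribed time interval
that stay `O(s)`-close to the unperturbed solution `(cos t, sin t)`. -/
theorem exists_perturbed_rotation {f g : ℝ × ℝ × ℝ → ℝ} (hf : ContDiff ℝ 1 f)
    (hg : ContDiff ℝ 1 g) {τ : ℝ} (hτ : 0 < τ) :
    ∃ M > 0, ∃ s₀ > 0, ∀ s ∈ Ioc 0 s₀, ∃ x y : ℝ → ℝ, x 0 = 1 ∧ y 0 = 0 ∧ ∀ t ∈ Icc 0 τ,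
      HasDerivWithinAt x (-y t + s * f (s, x t, y t)) (Icc 0 τ) t ∧
      HasDerivWithinAt y (x t + s * g (s, x t, y t)) (Icc 0 τ) t ∧
      |x t - Real.cos t| ≤ M * s ∧ |y t - Real.sin t| ≤ M * s := by
  -- Rotating coordinates: writing $(x,y)$ as the rotation by $t$ of $v$ removes the linear part and
  -- leaves $v'=sF(s,t,v)$.
  let X : ℝ × ℝ × ℝ × ℝ → ℝ := fun z =>
    z.2.2.1 * Real.cos z.2.1 - z.2.2.2 * Real.sin z.2.1
  let Y : ℝ × ℝ × ℝ × ℝ → ℝ := fun z =>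
    z.2.2.1 * Real.sin z.2.1 + z.2.2.2 * Real.cos z.2.1
  have hcos : ContDiff ℝ 1 fun z : ℝ × ℝ × ℝ × ℝ => Real.cos z.2.1 :=
    Real.contDiff_cos.comp (by fun_prop)
  have hsin : ContDiff ℝ 1 fun z : ℝ × ℝ × ℝ × ℝ => Real.sin z.2.1 :=
    Real.contDiff_sin.comp (by fun_prop)
  have hX : ContDiff ℝ 1 X := by fun_prop
  have hY : ContDiff ℝ 1 Y := by fun_prop
  have hf' : ContDiff ℝ 1 fun z => f (z.1, X z, Y z) := hf.comp (by fun_prop)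
  have hg' : ContDiff ℝ 1 fun z => g (z.1, X z, Y z) := hg.comp (by fun_prop)
  let F : ℝ × ℝ × ℝ × ℝ → ℝ × ℝ := fun z =>
    (Real.cos z.2.1 * f (z.1, X z, Y z) + Real.sin z.2.1 * g (z.1, X z, Y z),
      Real.cos z.2.1 * g (z.1, X z, Y z) - Real.sin z.2.1 * f (z.1, X z, Y z))
  have hF : ContDiff ℝ 1 F := by fun_prop
  obtain ⟨M, hM, s₀, hs₀, H⟩ := exists_solution_of_small_parameter hF ((1, 0) : ℝ × ℝ) hτ
  refine ⟨2 * M, by positivity, s₀, hs₀, fun s hs => ?_⟩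
  obtain ⟨v, hv0, hv⟩ := H s hs
  refine ⟨fun t => X (s, t, v t), fun t => Y (s, t, v t), by simp [X, hv0], by simp [Y, hv0],
    fun t ht => ?_⟩
  obtain ⟨hd, hb⟩ := hv t ht
  have h1 : HasDerivWithinAt (fun t => (v t).1) (s * (F (s, t, v t)).1) (Icc 0 τ) t :=
    by
    simpa using hd.hasFDerivWithinAt.fst.hasDerivWithinAt
  have h2 : HasDerivWithinAt (fun t => (v t).2) (s * (F (s, t, v t)).2) (Icc 0 τ) t :=
    by
    simpa using hd.hasFDerivWithinAt.snd.hasDerivWithinAt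
  have hc := (Real.hasDerivAt_cos t).hasDerivWithinAt (s := Icc 0 τ)
  have hs' := (Real.hasDerivAt_sin t).hasDerivWithinAt (s := Icc 0 τ)
  have hb1 : |(v t).1 - 1| ≤ M * s := (norm_fst_le (v t - (1, 0))).trans hb
  have hb2 : |(v t).2| ≤ M * s := by simpa using (norm_snd_le (v t - (1, 0))).trans hb
  have hmul : ∀ a b : ℝ, |a| ≤ M * s → |b| ≤ 1 → |a * b| ≤ M * s := fun a b ha hb => by
    rw [abs_mul]
    nlinarith [abs_nonneg a, abs_nonneg b]
  have htri := Real.sin_sq_add_cos_sq t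
  refine ⟨?_, ?_, ?_, ?_⟩
  · refine ((h1.mul hc).sub (h2.mul hs')).congr_deriv ?_
    simp only [F, X, Y]
    linear_combination (s * f (s, (v t).1 * Real.cos t - (v t).2 * Real.sin t,
      (v t).1 * Real.sin t + (v t).2 * Real.cos t)) * htri
  · refine ((h1.mul hs').add (h2.mul hc)).congr_deriv ?_
    simp only [F, X, Y]
    linear_combination (s * g (s, (v t).1 * Real.cos t - (v t).2 * Real.sin t,
      (v t).1 * Real.sin t + (v t).2 * Real.cos t)) * htri
  · have e1 := hmul _ _ hb1 (Real.abs_cos_le_one t)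
    have e2 := hmul _ _ hb2 (Real.abs_sin_le_one t)
    simp only [X]
    rw [abs_le] at *
    constructor <;> linarith
  · have e1 := hmul _ _ hb1 (Real.abs_sin_le_one t)
    have e2 := hmul _ _ hb2 (Real.abs_cos_le_one t)
    simp only [Y]
    rw [abs_le] at *
    constructor <;> linarith

/-! ### First returns: existence near time $2\pi$, and uniqueness. -/

theorem Real.half_le_cos_of_abs_le {t : ℝ} (ht : |t| ≤ Real.pi / 3) : 1 / 2 ≤ cos t := by
  rw [← cos_abs, ← cos_pi_div_three]
  exact cos_le_cos_of_nonneg_of_le_pi (abs_nonneg t) (by linarith [pi_pos]) ht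

theorem Real.cos_le_half_of_mem_Icc {t : ℝ} (ht : t ∈ Set.Icc (Real.pi / 3) (5 * Real.pi / 3)) :
    cos t ≤ 1 / 2 := by
  rw [← cos_pi_div_three]
  rcases le_total t Real.pi with h | h
  · exact cos_le_cos_of_nonneg_of_le_pi (by linarith [pi_pos]) h ht.1
  · rw [← cos_two_pi_sub t]
    exact cos_le_cos_of_nonneg_of_le_pi (by linarith [pi_pos]) (by linarith) (by linarith [ht.2])

open Set in
/-- A curve that stays close to `(cos t, sin t)`, and whose second coordinate has derivative close
to the first coordinate, first returns to the positive `x`-axis at a time close to `2π`. -/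
theorem exists_first_return_near_two_pi {x y d : ℝ → ℝ} {ε : ℝ} (hε : ε ≤ 1 / 10)
    (hy0 : y 0 = 0)
    (hx : ∀ t ∈ Icc 0 (7 * Real.pi / 3), |x t - Real.cos t| ≤ ε)
    (hy : ∀ t ∈ Icc 0 (7 * Real.pi / 3), |y t - Real.sin t| ≤ ε)
    (hd : ∀ t ∈ Icc 0 (7 * Real.pi / 3), |d t| ≤ 1 / 10)
    (hy' : ∀ t ∈ Icc 0 (7 * Real.pi / 3),
      HasDerivWithinAt y (x t + d t) (Icc 0 (7 * Real.pi / 3)) t) :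
    ∃ T ∈ Icc (5 * Real.pi / 3) (7 * Real.pi / 3), y T = 0 ∧ 0 < x T ∧
      |T - 2 * Real.pi| ≤ 2 * ε ∧ ∀ t ∈ Ioo 0 T, ¬ (0 < x t ∧ y t = 0) := by
  have hpi := Real.pi_pos
  have hmono : ∀ a b, 0 ≤ a → b ≤ 7 * Real.pi / 3 → (∀ t ∈ Icc a b, 1 / 2 ≤ Real.cos t) →
      StrictMonoOn y (Icc a b) := by
    intro a b ha hb hcos
    have hsub : Icc a b ⊆ Icc 0 (7 * Real.pi / 3) := Icc_subset_Icc ha hb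
    refine strictMonoOn_of_deriv_pos (convex_Icc a b)
      (fun t ht => (hy' t (hsub ht)).continuousWithinAt.mono hsub) fun t ht => ?_
    rw [interior_Icc] at ht
    have ht' := hsub (Ioo_subset_Icc_self ht)
    have hda : HasDerivAt y (x t + d t) t :=
      (hy' t ht').hasDerivAt (Icc_mem_nhds (ha.trans_lt ht.1) (ht.2.trans_le hb))
    rw [hda.deriv]
    have h1 := abs_le.1 (hx t ht')
    have h2 := abs_le.1 (hd t ht')
    linarith [hcos t (Ioo_subset_Icc_self ht)]
  have hcos2 : ∀ t ∈ Icc (5 * Real.pi / 3) (7 * Real.pi / 3), 1 / 2 ≤ Real.cos t := by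
    intro t ht
    rw [← Real.cos_sub_two_pi]
    refine Real.half_le_cos_of_abs_le (abs_le.2 ⟨?_, ?_⟩) <;> linarith [ht.1, ht.2]
  have hm1 : StrictMonoOn y (Icc 0 (Real.pi / 3)) := hmono _ _ le_rfl (by linarith) fun t ht =>
    Real.half_le_cos_of_abs_le (abs_le.2 ⟨by linarith [ht.1], ht.2⟩)
  have hm2 : StrictMonoOn y (Icc (5 * Real.pi / 3) (7 * Real.pi / 3)) :=
    hmono _ _ (by positivity) le_rfl hcos2
  have hsub2 : Icc (5 * Real.pi / 3) (7 * Real.pi / 3) ⊆ Icc 0 (7 * Real.pi / 3) :=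
    Icc_subset_Icc (by positivity) le_rfl
  have hle : 5 * Real.pi / 3 ≤ 7 * Real.pi / 3 := by linarith
  have hsq : (1 : ℝ) / 10 < √3 / 2 := by
    have : (1 : ℝ) < √3 := by
      rw [Real.lt_sqrt] <;> norm_num
    linarith
  have hyl : y (5 * Real.pi / 3) ≤ 0 := by
    have h := abs_le.1 (hy _ (hsub2 (left_mem_Icc.2 hle)))
    have : Real.sin (5 * Real.pi / 3) = -(√3 / 2) := by
      rw [show 5 * Real.pi / 3 = 2 * Real.pi - Real.pi / 3 by ring, Real.sin_two_pi_sub,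
        Real.sin_pi_div_three]
    linarith
  have hyr : 0 ≤ y (7 * Real.pi / 3) := by
    have h := abs_le.1 (hy _ (hsub2 (right_mem_Icc.2 hle)))
    have : Real.sin (7 * Real.pi / 3) = √3 / 2 := by
      rw [show 7 * Real.pi / 3 = Real.pi / 3 + 2 * Real.pi by ring, Real.sin_add_two_pi,
        Real.sin_pi_div_three]
    linarith
  have hcont : ContinuousOn y (Icc (5 * Real.pi / 3) (7 * Real.pi / 3)) := fun t ht =>
    (hy' t (hsub2 ht)).continuousWithinAt.mono hsub2
  obtain ⟨T, hT, hyT⟩ := intermediate_value_Icc hle hcont ⟨hyl, hyr⟩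
  have hxT := abs_le.1 (hx T (hsub2 hT))
  refine ⟨T, hT, hyT, by linarith [hcos2 T hT], ?_, fun t ht => ?_⟩
  · have h := hy T (hsub2 hT)
    rw [hyT, zero_sub, abs_neg, ← Real.sin_sub_two_pi] at h
    -- Jordan's inequality turns $|\sin(T-2\pi)|\le\varepsilon$ into
    -- $|T-2\pi|\le\frac{\pi}{2}\varepsilon\le2\varepsilon$.
    have h2 := Real.mul_abs_le_abs_sin (x := T - 2 * Real.pi)
      (abs_le.2 ⟨by linarith [hT.1], by linarith [hT.2]⟩)
    have h3 := h2.trans h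
    rw [div_mul_eq_mul_div, div_le_iff₀ hpi] at h3
    have := Real.pi_lt_four
    nlinarith [abs_nonneg (Real.sin (T - 2 * Real.pi))]
  · rintro ⟨hxt, hyt⟩
    have htm : t ∈ Icc 0 (7 * Real.pi / 3) := ⟨ht.1.le, ht.2.le.trans hT.2⟩
    rcases le_total t (Real.pi / 3) with h1 | h1
    · have := hm1 (left_mem_Icc.2 (by positivity)) ⟨ht.1.le, h1⟩ ht.1
      linarith
    rcases le_total t (5 * Real.pi / 3) with h2 | h2
    · have hc := Real.cos_le_half_of_mem_Icc ⟨h1, h2⟩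
      have h3 := abs_le.1 (hx t htm)
      have h4 := abs_le.1 (hy t htm)
      nlinarith [Real.sin_sq_add_cos_sq t]
    · have := hm2 ⟨h2, htm.2⟩ hT ht.2
      linarith

open Set in
/-- Two integral curves of a `C¹` vector field with the same initial value agree. -/
theorem IsIntegralCurveOn.eqOn_Icc_of_contDiff {E : Type*} [NormedAddCommGroup E] [NormedSpace ℝ E]
    {X : E → E} (hX : ContDiff ℝ 1 X) {γ₁ γ₂ : ℝ → E} {T₁ T₂ : ℝ} (hT : T₁ ≤ T₂)
    (h₁ : IsIntegralCurveOn γ₁ (fun _ => X) (Icc 0 T₁))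
    (h₂ : IsIntegralCurveOn γ₂ (fun _ => X) (Icc 0 T₂)) (h0 : γ₁ 0 = γ₂ 0) :
    EqOn γ₁ γ₂ (Icc 0 T₁) := by
  have hC : IsCompact (γ₁ '' Icc 0 T₁ ∪ γ₂ '' Icc 0 T₂) :=
    (isCompact_Icc.image_of_continuousOn h₁.continuousOn).union
      (isCompact_Icc.image_of_continuousOn h₂.continuousOn)
  obtain ⟨K, hK⟩ := hX.exists_lipschitzOnWith_of_isCompact hC
  have hsub : Icc 0 T₁ ⊆ Icc 0 T₂ := Icc_subset_Icc_right hT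
  refine ODE_solution_unique_of_mem_Icc_right (v := fun _ => X)
    (s := fun _ => γ₁ '' Icc 0 T₁ ∪ γ₂ '' Icc 0 T₂) (fun _ _ => hK)
    h₁.continuousOn (fun t ht => ?_) (fun t ht => ?_)
    (h₂.continuousOn.mono hsub) (fun t ht => ?_) (fun t ht => ?_) h0
  · exact (h₁ t (Ico_subset_Icc_self ht)).mono_of_mem_nhdsWithin (Icc_mem_nhdsGE_of_mem ht)
  · exact Or.inl (mem_image_of_mem _ (Ico_subset_Icc_self ht))
  · exact (h₂ t (hsub (Ico_subset_Icc_self ht))).mono_of_mem_nhdsWithin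
      (Icc_mem_nhdsGE_of_mem ⟨ht.1, ht.2.trans_le hT⟩)
  · exact Or.inr (mem_image_of_mem _ (hsub (Ico_subset_Icc_self ht)))

/-- The first return point of a trajectory of a `C¹` vector field is unique. -/
theorem IsFirstReturn.unique {X : ℝ × ℝ → ℝ × ℝ} (hX : ContDiff ℝ 1 X) {s a b : ℝ}
    (ha : IsFirstReturn X s a) (hb : IsFirstReturn X s b) : a = b := by
  wlog h : ha.2.choose ≤ hb.2.choose generalizing a b
  · exact (this hb ha (le_of_not_ge h)).symm
  obtain ⟨γ, hT, hγ, hγ0, hγT, -⟩ := ha.2.choose_spec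
  obtain ⟨δ, -, hδ, hδ0, hδT, hδn⟩ := hb.2.choose_spec
  have heq := hγ.eqOn_Icc_of_contDiff hX h hδ (hγ0.trans hδ0.symm)
    (Set.right_mem_Icc.2 hT.le)
  -- A strictly earlier return would be a forbidden crossing on the longer trajectory.
  rcases h.lt_or_eq with h | h
  · refine absurd ⟨?_, ?_⟩ (hδn _ ⟨hT, h⟩) <;> rw [← heq, hγT]
    exact ha.1
  · rw [hγT, h, hδT] at heq
    exact congrArg Prod.fst heq

open Set in
/-- Small perturbations of the planar rotation return to the positive `x`-axis after a time
`2π + O(s)`. -/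
theorem exists_first_return_perturbed_rotation {f g : ℝ × ℝ × ℝ → ℝ} (hf : ContDiff ℝ 1 f)
    (hg : ContDiff ℝ 1 g) :
    ∃ M > 0, ∃ s₀ > 0, s₀ ≤ 1 ∧ M * s₀ ≤ 1 ∧ ∀ s ∈ Ioc 0 s₀, ∃ (T : ℝ) (x y : ℝ → ℝ),
      0 < T ∧ x 0 = 1 ∧ y 0 = 0 ∧ 0 < x T ∧ y T = 0 ∧ |T - 2 * Real.pi| ≤ M * s ∧
      (∀ t ∈ Ioo 0 T, ¬ (0 < x t ∧ y t = 0)) ∧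
      ∀ t ∈ Icc 0 T, HasDerivWithinAt x (-y t + s * f (s, x t, y t)) (Icc 0 T) t ∧
        HasDerivWithinAt y (x t + s * g (s, x t, y t)) (Icc 0 T) t ∧
        |x t - Real.cos t| ≤ M * s ∧ |y t - Real.sin t| ≤ M * s := by
  have hpi := Real.pi_pos
  obtain ⟨M, hM, s₁, hs₁, H⟩ := exists_perturbed_rotation hf hg
    (show 0 < 7 * Real.pi / 3 by positivity)
  have hC : IsCompact (Icc (0 : ℝ) 1 ×ˢ Icc (-2 : ℝ) 2 ×ˢ Icc (-2 : ℝ) 2) :=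
    isCompact_Icc.prod (isCompact_Icc.prod isCompact_Icc)
  obtain ⟨B, hB⟩ := hC.exists_bound_of_continuousOn hg.continuous.continuousOn
  refine ⟨2 * M, by positivity, min s₁ (min 1 (min (1 / (10 * M)) (1 / (10 * (|B| + 1))))),
    by positivity, (min_le_right _ _).trans (min_le_left _ _), ?_, fun s hs => ?_⟩
  · have : min s₁ (min 1 (min (1 / (10 * M)) (1 / (10 * (|B| + 1))))) ≤ 1 / (10 * M) :=
      (min_le_right _ _).trans ((min_le_right _ _).trans (min_le_left _ _))
    rw [le_div_iff₀ (by positivity)] at this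
    linarith
  obtain ⟨hs0, hs⟩ := hs
  simp only [le_min_iff] at hs
  obtain ⟨hss₁, hs1, hsM, hsB⟩ := hs
  rw [le_div_iff₀ (by positivity)] at hsM hsB
  have hε : M * s ≤ 1 / 10 := by linarith
  obtain ⟨x, y, hx0, hy0, hxy⟩ := H s ⟨hs0, hss₁⟩
  obtain ⟨T, hT, hyT, hxT, hT2, hn⟩ := exists_first_return_near_two_pi (x := x) (y := y)
    (d := fun t => s * g (s, x t, y t)) hε hy0 (fun t ht => (hxy t ht).2.2.1)
    (fun t ht => (hxy t ht).2.2.2) (fun t ht => by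
      obtain ⟨-, -, h1, h2⟩ := hxy t ht
      rw [abs_le] at h1 h2
      have hb := hB (s, x t, y t) ⟨⟨hs0.le, hs1⟩,
        ⟨by linarith [Real.neg_one_le_cos t], by linarith [Real.cos_le_one t]⟩,
        ⟨by linarith [Real.neg_one_le_sin t], by linarith [Real.sin_le_one t]⟩⟩
      rw [Real.norm_eq_abs] at hb
      rw [abs_mul, abs_of_pos hs0]
      nlinarith [le_abs_self B]) (fun t ht => (hxy t ht).2.1)
  have hsub : Icc 0 T ⊆ Icc 0 (7 * Real.pi / 3) := Icc_subset_Icc_right hT.2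
  refine ⟨T, x, y, by linarith [hT.1], hx0, hy0, hxT, hyT, by linarith, hn, fun t ht => ?_⟩
  obtain ⟨h1, h2, h3, h4⟩ := hxy t (hsub ht)
  have : 0 < M * s := by positivity
  exact ⟨h1.mono hsub, h2.mono hsub, by linarith, by linarith⟩

/-! ### Andronov's formula through a Liapunov function. -/

open Set in
/-- The increment of a function on `[0, T]` whose derivative is nearly constant. -/
theorem abs_sub_sub_mul_le_of_hasDerivWithinAt {w w' : ℝ → ℝ} {T k ε : ℝ} (hT : 0 ≤ T)
    (hw : ∀ t ∈ Icc 0 T, HasDerivWithinAt w (w' t) (Icc 0 T) t)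
    (hk : ∀ t ∈ Icc 0 T, |w' t - k| ≤ ε) : |w T - w 0 - k * T| ≤ ε * T := by
  have h := (convex_Icc 0 T).norm_image_sub_le_of_norm_hasDerivWithin_le
    (f := fun t => w t - k * t) (f' := fun t => w' t - k) (C := ε)
    (fun t ht => ((hw t ht).sub ((hasDerivWithinAt_id t _).const_mul k)).congr_deriv (by simp))
    hk (left_mem_Icc.2 hT) (right_mem_Icc.2 hT)
  rw [Real.norm_eq_abs, Real.norm_eq_abs, sub_zero, abs_of_nonneg hT] at h
  refine le_trans (le_of_eq ?_) h
  congr 1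
  ring

/-- Solving `ρ² - 1 + O(s) (ρ - 1) = 2 k s² + O(s³)` for `ρ` close to `1`. -/
theorem isBigO_sub_one_sub_of_quartic {l : Filter ℝ} {ρ : ℝ → ℝ} {k c₃ c₄ : ℝ}
    (hl : Tendsto (fun s : ℝ => s) l (𝓝 0))
    (hρ : (fun s => ρ s - 1) =O[l] fun s => s)
    (h : (fun s => (ρ s ^ 2 + s * (c₃ * ρ s ^ 3) + s ^ 2 * (c₄ * ρ s ^ 4))
      - (1 + s * c₃ + s ^ 2 * c₄) - 2 * k * s ^ 2) =O[l] fun s => s ^ 3) :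
    (fun s => ρ s - 1 - k * s ^ 2) =O[l] fun s => s ^ 3 := by
  have hone : (fun s : ℝ => s) =O[l] fun _ => (1 : ℝ) := hl.isBigO_one ℝ
  have hρ1 : ρ =O[l] fun _ => (1 : ℝ) := by
    have := (hρ.trans hone).add (isBigO_const_const (1 : ℝ) (one_ne_zero (α := ℝ)) l)
    simpa using this
  have hpow : ∀ n : ℕ, (fun s => ρ s ^ n) =O[l] fun _ => (1 : ℝ) := fun n => by
    simpa using hρ1.pow n
  have hid : (fun s : ℝ => s) =O[l] fun s => s := isBigO_refl _ _
  have hh : (fun s => (ρ s - 1) + s * (c₃ * (ρ s ^ 2 + ρ s ^ 1 + ρ s ^ 0)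
      + s * (c₄ * (ρ s ^ 3 + ρ s ^ 2 + ρ s ^ 1 + ρ s ^ 0)))) =O[l] fun s => s := by
    refine hρ.add ?_
    have h3 := (((hpow 2).add (hpow 1)).add (hpow 0)).const_mul_left c₃
    have h4 := ((((hpow 3).add (hpow 2)).add (hpow 1)).add (hpow 0)).const_mul_left c₄
    have h5 := hone.mul h4
    simp only [mul_one] at h5
    simpa using hid.mul (h3.add h5)
  have hs32 : (fun s : ℝ => s ^ 3) =O[l] fun s => s ^ 2 := by
    have := (isBigO_refl (fun s : ℝ => s ^ 2) l).mul hone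
    simpa [pow_succ] using this
  have hprod1 : (fun s => (ρ s - 1) * ((ρ s - 1) + s * (c₃ * (ρ s ^ 2 + ρ s ^ 1 + ρ s ^ 0)
      + s * (c₄ * (ρ s ^ 3 + ρ s ^ 2 + ρ s ^ 1 + ρ s ^ 0))))) =O[l] fun s => s ^ 2 := by
    simpa only [pow_two] using hρ.mul hh
  -- Bootstrap: the hypothesis reads $2(\rho-1)+(\rho-1)h-2ks^2=O(s^3)$ with $h=O(s)$. The bound
  -- $\rho-1=O(s)$ improves to $O(s^2)$, which makes the product $O(s^3)$.
  have hu2 : (fun s => ρ s - 1) =O[l] fun s => s ^ 2 := by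
    have := ((((h.trans hs32).add ((isBigO_refl (fun s : ℝ => s ^ 2) l).const_mul_left
      (2 * k))).sub hprod1).const_mul_left (1 / 2))
    refine this.congr_left fun s => ?_
    ring
  have hprod2 : (fun s => (ρ s - 1) * ((ρ s - 1) + s * (c₃ * (ρ s ^ 2 + ρ s ^ 1 + ρ s ^ 0)
      + s * (c₄ * (ρ s ^ 3 + ρ s ^ 2 + ρ s ^ 1 + ρ s ^ 0))))) =O[l] fun s => s ^ 3 := by
    simpa only [pow_succ] using hu2.mul hh
  refine ((h.sub hprod2).const_mul_left (1 / 2)).congr_left fun s => ?_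
  ring

/-- The derivative of a quartic polynomial, without linear terms, along a planar curve. -/
theorem HasDerivWithinAt.quartic {x y : ℝ → ℝ} {x' y' t : ℝ} {S : Set ℝ}
    (hx : HasDerivWithinAt x x' S t) (hy : HasDerivWithinAt y y' S t)
    (s c₃₀ c₂₁ c₁₂ c₀₃ c₄₀ c₃₁ c₁₃ c₀₄ : ℝ) :
    HasDerivWithinAt (fun t => x t ^ 2 + y t ^ 2
      + s * (c₃₀ * x t ^ 3 + c₂₁ * (x t ^ 2 * y t) + c₁₂ * (x t * y t ^ 2) + c₀₃ * y t ^ 3)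
      + s ^ 2 * (c₄₀ * x t ^ 4 + c₃₁ * (x t ^ 3 * y t) + c₁₃ * (x t * y t ^ 3) + c₀₄ * y t ^ 4))
      ((2 * x t + s * (3 * c₃₀ * x t ^ 2 + 2 * c₂₁ * x t * y t + c₁₂ * y t ^ 2)
        + s ^ 2 * (4 * c₄₀ * x t ^ 3 + 3 * c₃₁ * x t ^ 2 * y t + c₁₃ * y t ^ 3)) * x'
      + (2 * y t + s * (c₂₁ * x t ^ 2 + 2 * c₁₂ * x t * y t + 3 * c₀₃ * y t ^ 2)
        + s ^ 2 * (c₃₁ * x t ^ 3 + 3 * c₁₃ * x t * y t ^ 2 + 4 * c₀₄ * y t ^ 3)) * y') S t := by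
  refine ((((hx.fun_pow 2).add (hy.fun_pow 2)).add
    (((((hx.fun_pow 3).const_mul c₃₀).add (((hx.fun_pow 2).mul hy).const_mul c₂₁)).add
      ((hx.mul (hy.fun_pow 2)).const_mul c₁₂)).add
      ((hy.fun_pow 3).const_mul c₀₃) |>.const_mul s)).add
    (((((hx.fun_pow 4).const_mul c₄₀).add (((hx.fun_pow 3).mul hy).const_mul c₃₁)).add
      ((hx.mul (hy.fun_pow 3)).const_mul c₁₃)).add
      ((hy.fun_pow 4).const_mul c₀₄) |>.const_mul (s ^ 2))).congr_deriv ?_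
  simp
  ring

open Set in
/-- **The Liapunov number of a weak focus.** A planar vector field with linear part `(-y, x)`, given
by its third order expansion at the origin with `C¹` rescaled remainders, has a Liapunov number,
which is given by Andronov's formula. -/
theorem isLiapunovNumber_of_expansion {X : ℝ × ℝ → ℝ × ℝ} {p q : ℝ × ℝ × ℝ → ℝ}
    (hp : ContDiff ℝ 1 p) (hq : ContDiff ℝ 1 q)
    (a₂₀ a₁₁ a₀₂ a₃₀ a₂₁ a₁₂ a₀₃ b₂₀ b₁₁ b₀₂ b₃₀ b₂₁ b₁₂ b₀₃ : ℝ)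
    (hX : ∀ s x y : ℝ, X (s * x, s * y) =
      (-(s * y) + s ^ 2 * (a₂₀ * x ^ 2 + a₁₁ * x * y + a₀₂ * y ^ 2)
        + s ^ 3 * (a₃₀ * x ^ 3 + a₂₁ * x ^ 2 * y + a₁₂ * x * y ^ 2 + a₀₃ * y ^ 3)
        + s ^ 4 * p (s, x, y),
      s * x + s ^ 2 * (b₂₀ * x ^ 2 + b₁₁ * x * y + b₀₂ * y ^ 2)
        + s ^ 3 * (b₃₀ * x ^ 3 + b₂₁ * x ^ 2 * y + b₁₂ * x * y ^ 2 + b₀₃ * y ^ 3)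
        + s ^ 4 * q (s, x, y))) :
    IsLiapunovNumber X (3 * Real.pi / 2 * (3 * (a₃₀ + b₀₃) + a₁₂ + b₂₁
      + a₁₁ * (a₂₀ + a₀₂) - b₁₁ * (b₂₀ + b₀₂) - 2 * a₂₀ * b₂₀ + 2 * a₀₂ * b₀₂)) := by
  have hpi := Real.pi_pos
  let p₂ : ℝ × ℝ × ℝ → ℝ := fun z => a₂₀ * z.2.1 ^ 2 + a₁₁ * z.2.1 * z.2.2 + a₀₂ * z.2.2 ^ 2
  let q₂ : ℝ × ℝ × ℝ → ℝ := fun z => b₂₀ * z.2.1 ^ 2 + b₁₁ * z.2.1 * z.2.2 + b₀₂ * z.2.2 ^ 2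
  let p₃ : ℝ × ℝ × ℝ → ℝ := fun z => a₃₀ * z.2.1 ^ 3 + a₂₁ * z.2.1 ^ 2 * z.2.2
    + a₁₂ * z.2.1 * z.2.2 ^ 2 + a₀₃ * z.2.2 ^ 3
  let q₃ : ℝ × ℝ × ℝ → ℝ := fun z => b₃₀ * z.2.1 ^ 3 + b₂₁ * z.2.1 ^ 2 * z.2.2
    + b₁₂ * z.2.1 * z.2.2 ^ 2 + b₀₃ * z.2.2 ^ 3
  let f : ℝ × ℝ × ℝ → ℝ := fun z => p₂ z + z.1 * p₃ z + z.1 ^ 2 * p z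
  let g : ℝ × ℝ × ℝ → ℝ := fun z => q₂ z + z.1 * q₃ z + z.1 ^ 2 * q z
  have hf : ContDiff ℝ 1 f := by fun_prop
  have hg : ContDiff ℝ 1 g := by fun_prop
  have hXfg : ∀ s x y : ℝ, X (s * x, s * y) =
      (s * (-y + s * f (s, x, y)), s * (x + s * g (s, x, y))) := fun s x y => by
    rw [hX]
    ext <;> simp only [f, g, p₂, p₃, q₂, q₃] <;> ring
  have hX1 : ContDiff ℝ 1 X := by
    have : X = fun z => (-z.2 + f (1, z), z.1 + g (1, z)) := by
      funext z
      simpa using hXfg 1 z.1 z.2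
    rw [this]
    fun_prop
  -- coefficients of the Liapunov function
  let c₃₀ := (4 * b₀₂ + 2 * a₁₁ + 2 * b₂₀) / 3
  let c₂₁ := -2 * a₂₀
  let c₁₂ := 2 * b₀₂
  let c₀₃ := (-4 * a₂₀ - 2 * a₀₂ - 2 * b₁₁) / 3
  -- `rᵢ` is the coefficient of $x^iy^{4-i}$ in the quartic form to be compensated at order $s^2$.
  let r₄ := 2 * a₃₀ + 3 * c₃₀ * a₂₀ + c₂₁ * b₂₀
  let r₃ := 2 * (a₂₁ + b₃₀) + 3 * c₃₀ * a₁₁ + 2 * c₂₁ * a₂₀ + c₂₁ * b₁₁ + 2 * c₁₂ * b₂₀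
  let r₁ := 2 * (a₀₃ + b₁₂) + 2 * c₂₁ * a₀₂ + c₁₂ * a₁₁ + 2 * c₁₂ * b₀₂ + 3 * c₀₃ * b₁₁
  let r₀ := 2 * b₀₃ + c₁₂ * a₀₂ + 3 * c₀₃ * b₀₂
  -- On quartic forms $x\partial_y-y\partial_x$ is not onto: the circle mean $c=(3r_4+r_2+3r_0)/8$
  -- must survive. Its kernel is spanned by $(x^2+y^2)^2$, so the $x^2y^2$ term of the quartic can
  -- be taken to be 0.
  let c := (3 * (a₃₀ + b₀₃) + a₁₂ + b₂₁
      + a₁₁ * (a₂₀ + a₀₂) - b₁₁ * (b₂₀ + b₀₂) - 2 * a₂₀ * b₂₀ + 2 * a₀₂ * b₀₂) / 4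
  let c₄₀ := r₃ / 4
  let c₃₁ := c - r₄
  let c₁₃ := r₀ - c
  let c₀₄ := -r₁ / 4
  let U₃ : ℝ × ℝ × ℝ → ℝ := fun z =>
    3 * c₃₀ * z.2.1 ^ 2 + 2 * c₂₁ * z.2.1 * z.2.2 + c₁₂ * z.2.2 ^ 2
  let W₃ : ℝ × ℝ × ℝ → ℝ := fun z =>
    c₂₁ * z.2.1 ^ 2 + 2 * c₁₂ * z.2.1 * z.2.2 + 3 * c₀₃ * z.2.2 ^ 2
  let U₄ : ℝ × ℝ × ℝ → ℝ := fun z =>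
    4 * c₄₀ * z.2.1 ^ 3 + 3 * c₃₁ * z.2.1 ^ 2 * z.2.2 + c₁₃ * z.2.2 ^ 3
  let W₄ : ℝ × ℝ × ℝ → ℝ := fun z =>
    c₃₁ * z.2.1 ^ 3 + 3 * c₁₃ * z.2.1 * z.2.2 ^ 2 + 4 * c₀₄ * z.2.2 ^ 3
  let R : ℝ × ℝ × ℝ → ℝ := fun z =>
    2 * z.2.1 * p z + 2 * z.2.2 * q z + U₃ z * (p₃ z + z.1 * p z) + W₃ z * (q₃ z + z.1 * q z)
      + U₄ z * f z + W₄ z * g z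
  have hid : ∀ z : ℝ × ℝ × ℝ,
      (2 * z.2.1 + z.1 * U₃ z + z.1 ^ 2 * U₄ z) * (-z.2.2 + z.1 * f z)
        + (2 * z.2.2 + z.1 * W₃ z + z.1 ^ 2 * W₄ z) * (z.2.1 + z.1 * g z)
      = z.1 ^ 2 * (c * (z.2.1 ^ 2 + z.2.2 ^ 2) ^ 2) + z.1 ^ 3 * R z := fun z => by
    simp only [R, f, g]
    -- `e3` and `e4` are the homological equations at orders $s$ and $s^2$.
    have e3 : z.2.1 * W₃ z - z.2.2 * U₃ z + 2 * (z.2.1 * p₂ z + z.2.2 * q₂ z) = 0 := by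
      simp only [U₃, W₃, p₂, q₂, c₃₀, c₂₁, c₁₂, c₀₃]
      ring
    have e4 : z.2.1 * W₄ z - z.2.2 * U₄ z + 2 * (z.2.1 * p₃ z + z.2.2 * q₃ z)
        + U₃ z * p₂ z + W₃ z * q₂ z = c * (z.2.1 ^ 2 + z.2.2 ^ 2) ^ 2 := by
      simp only [U₃, W₃, U₄, W₄, p₂, q₂, p₃, q₃, c₄₀, c₃₁, c₁₃, c₀₄, r₀, r₁, r₃, r₄, c, c₃₀, c₂₁,
        c₁₂, c₀₃]
      ring
    linear_combination z.1 * e3 + z.1 ^ 2 * e4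
  have hC : IsCompact (Icc (0 : ℝ) 1 ×ˢ Icc (-2 : ℝ) 2 ×ˢ Icc (-2 : ℝ) 2) :=
    isCompact_Icc.prod (isCompact_Icc.prod isCompact_Icc)
  have hRc : Continuous R := by
    have := hp.continuous
    have := hq.continuous
    have := hf.continuous
    have := hg.continuous
    fun_prop
  obtain ⟨B, hB⟩ := hC.exists_bound_of_continuousOn hRc.continuousOn
  obtain ⟨M, hM, s₀, hs₀, hs₀1, hMs₀, H⟩ := exists_first_return_perturbed_rotation hf hg
  have H' : ∀ s, ∃ (T : ℝ) (x y : ℝ → ℝ), s ∈ Ioc 0 s₀ →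
      0 < T ∧ x 0 = 1 ∧ y 0 = 0 ∧ 0 < x T ∧ y T = 0 ∧ |T - 2 * Real.pi| ≤ M * s ∧
      (∀ t ∈ Ioo 0 T, ¬ (0 < x t ∧ y t = 0)) ∧
      ∀ t ∈ Icc 0 T, HasDerivWithinAt x (-y t + s * f (s, x t, y t)) (Icc 0 T) t ∧
        HasDerivWithinAt y (x t + s * g (s, x t, y t)) (Icc 0 T) t ∧
        |x t - Real.cos t| ≤ M * s ∧ |y t - Real.sin t| ≤ M * s := fun s => by
    by_cases hs : s ∈ Ioc 0 s₀
    · obtain ⟨T, x, y, h⟩ := H s hs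
      exact ⟨T, x, y, fun _ => h⟩
    · exact ⟨0, 0, 0, fun h => absurd h hs⟩
  choose T x y hxy using H'
  have hmem : ∀ᶠ s in 𝓝[>] (0 : ℝ), s ∈ Ioc 0 s₀ := Ioc_mem_nhdsGT hs₀
  have hl : Tendsto (fun s : ℝ => s) (𝓝[>] (0 : ℝ)) (𝓝 0) := nhdsWithin_le_nhds
  have hTO : (fun s => T s - 2 * Real.pi) =O[𝓝[>] 0] fun s : ℝ => s := by
    refine IsBigO.of_bound M ?_
    filter_upwards [hmem] with s hs
    rw [Real.norm_eq_abs, Real.norm_of_nonneg hs.1.le]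
    exact (hxy s hs).2.2.2.2.2.1
  have hρO : (fun s => x s (T s) - 1) =O[𝓝[>] 0] fun s : ℝ => s := by
    refine IsBigO.of_bound (2 * M) ?_
    filter_upwards [hmem] with s hs
    obtain ⟨hT, -, -, -, -, hT2, -, h⟩ := hxy s hs
    have h1 := (h _ (right_mem_Icc.2 hT.le)).2.2.1
    have h2 : |Real.cos (T s) - 1| ≤ |T s - 2 * Real.pi| := by
      simpa using Real.abs_cos_sub_cos_le (T s) (2 * Real.pi)
    rw [Real.norm_eq_abs, Real.norm_of_nonneg hs.1.le]
    calc |x s (T s) - 1| ≤ |x s (T s) - Real.cos (T s)| + |Real.cos (T s) - 1| :=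
          abs_sub_le _ _ _
      _ ≤ 2 * M * s := by linarith
  -- At both ends of the turn $y=0$, so only the pure powers of $x$ in $W$ remain.
  have hW : (fun s => (x s (T s) ^ 2 + s * (c₃₀ * x s (T s) ^ 3) + s ^ 2 * (c₄₀ * x s (T s) ^ 4))
      - (1 + s * c₃₀ + s ^ 2 * c₄₀) - s ^ 2 * c * T s) =O[𝓝[>] 0] fun s : ℝ => s ^ 3 := by
    refine IsBigO.of_bound ((|c| * (60 * M) + |B|) * (2 * Real.pi + 1)) ?_
    filter_upwards [hmem] with s hs
    obtain ⟨hT, hx0, hy0, -, hyT, hT2, -, h⟩ := hxy s hs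
    have hMs : M * s ≤ 1 := le_trans (by gcongr; exact hs.2) hMs₀
    have hs3 : 0 < s ^ 3 := pow_pos hs.1 3
    have key := abs_sub_sub_mul_le_of_hasDerivWithinAt (k := s ^ 2 * c)
      (ε := (|c| * (60 * M) + |B|) * s ^ 3) hT.le
      (fun t ht => (h t ht).1.quartic (h t ht).2.1 s c₃₀ c₂₁ c₁₂ c₀₃ c₄₀ c₃₁ c₁₃ c₀₄)
      (fun t ht => ?_)
    · simp only [hx0, hy0, hyT] at key
      rw [Real.norm_eq_abs, Real.norm_of_nonneg hs3.le]
      refine le_trans (le_of_eq ?_) (key.trans ?_)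
      · congr 1
        ring
      · have hT3 : T s ≤ 2 * Real.pi + 1 := by linarith [(abs_le.1 hT2).2]
        calc (|c| * (60 * M) + |B|) * s ^ 3 * T s
            ≤ (|c| * (60 * M) + |B|) * s ^ 3 * (2 * Real.pi + 1) := by gcongr
          _ = _ := by ring
    · obtain ⟨-, -, hxc, hys⟩ := h t ht
      have e := hid (s, x s t, y s t)
      simp only [U₃, W₃, U₄, W₄] at e
      rw [e]
      have hxc' := abs_le.1 hxc
      have hys' := abs_le.1 hys
      have hc1 := Real.neg_one_le_cos t
      have hc2 := Real.cos_le_one t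
      have hs1 := Real.neg_one_le_sin t
      have hs2 := Real.sin_le_one t
      have hR := hB (s, x s t, y s t) ⟨⟨hs.1.le, hs.2.trans hs₀1⟩,
        ⟨by linarith, by linarith⟩, ⟨by linarith, by linarith⟩⟩
      rw [Real.norm_eq_abs] at hR
      have hr : |(x s t ^ 2 + y s t ^ 2) - 1| ≤ 6 * (M * s) := by
        have e : (x s t ^ 2 + y s t ^ 2) - 1 = (x s t - Real.cos t) * (x s t + Real.cos t)
            + (y s t - Real.sin t) * (y s t + Real.sin t) := by
          linear_combination Real.sin_sq_add_cos_sq t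
        have h1 : |x s t + Real.cos t| ≤ 3 := abs_le.2 ⟨by linarith, by linarith⟩
        have h2 : |y s t + Real.sin t| ≤ 3 := abs_le.2 ⟨by linarith, by linarith⟩
        rw [e]
        refine (abs_add_le _ _).trans ?_
        rw [abs_mul, abs_mul]
        have := mul_le_mul hxc h1 (abs_nonneg _) ((abs_nonneg _).trans hxc)
        have := mul_le_mul hys h2 (abs_nonneg _) ((abs_nonneg _).trans hys)
        linarith
      have hr2 : |(x s t ^ 2 + y s t ^ 2) ^ 2 - 1| ≤ 60 * (M * s) := by
        have h1 : |(x s t ^ 2 + y s t ^ 2) + 1| ≤ 10 := by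
          rw [abs_of_nonneg (by positivity)]
          linarith [(abs_le.1 hr).2]
        rw [show (x s t ^ 2 + y s t ^ 2) ^ 2 - 1
          = ((x s t ^ 2 + y s t ^ 2) - 1) * ((x s t ^ 2 + y s t ^ 2) + 1) by ring, abs_mul]
        have := mul_le_mul hr h1 (abs_nonneg _) ((abs_nonneg _).trans hr)
        linarith
      have e2 : s ^ 2 * (c * (x s t ^ 2 + y s t ^ 2) ^ 2) + s ^ 3 * R (s, x s t, y s t) - s ^ 2 * c
          = s ^ 2 * (c * ((x s t ^ 2 + y s t ^ 2) ^ 2 - 1)) + s ^ 3 * R (s, x s t, y s t) := by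
        ring
      rw [e2]
      calc _ ≤ s ^ 2 * (|c| * |(x s t ^ 2 + y s t ^ 2) ^ 2 - 1|)
            + s ^ 3 * |R (s, x s t, y s t)| := by
            refine (abs_add_le _ _).trans (le_of_eq ?_)
            rw [abs_mul, abs_mul, abs_mul, abs_of_pos hs3, abs_of_nonneg (sq_nonneg s)]
        _ ≤ s ^ 2 * (|c| * (60 * (M * s))) + s ^ 3 * |B| := by
            have hR' := hR.trans (le_abs_self B)
            exact add_le_add (by gcongr) (mul_le_mul_of_nonneg_left hR' hs3.le)
        _ = _ := by ring
  have hs2T : (fun s => s ^ 2 * c * (T s - 2 * Real.pi)) =O[𝓝[>] 0] fun s : ℝ => s ^ 3 := by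
    have := ((isBigO_refl (fun s : ℝ => s ^ 2) (𝓝[>] 0)).mul (hTO.const_mul_left c))
    refine (this.congr_left fun s => ?_).congr_right fun s => ?_ <;> ring
  have hρ := isBigO_sub_one_sub_of_quartic (k := Real.pi * c) (c₃ := c₃₀) (c₄ := c₄₀) hl hρO
    ((hW.add hs2T).congr_left fun s => by ring)
  -- Undoing the blow-up multiplies the return point by $s$.
  refine ⟨fun s => s * x s (T s), ?_, ?_⟩
  · filter_upwards [hmem] with s hs
    obtain ⟨hT, hx0, hy0, hxT, hyT, -, hn, h⟩ := hxy s hs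
    have hret : IsFirstReturn X s (s * x s (T s)) := by
      refine ⟨mul_pos hs.1 hxT, T s, fun t => (s * x s t, s * y s t), hT, fun t ht => ?_, ?_, ?_,
        fun t ht => ?_⟩
      · have := ((h t ht).1.const_mul s).prodMk ((h t ht).2.1.const_mul s)
        rwa [← hXfg] at this
      · simp [hx0, hy0]
      · simp [hyT]
      · simpa [hs.1, hs.1.ne'] using hn t ht
    exact fun s' => ⟨fun h' => h'.unique hX1 hret, fun h' => h' ▸ hret⟩
  · have h4 := (isBigO_refl (fun s : ℝ => s) (𝓝[>] 0)).mul hρ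
    have h5 : (fun s : ℝ => s * s ^ 3) =o[𝓝[>] 0] fun s => s ^ 3 := by
      simpa using ((isLittleO_one_iff ℝ).2 hl).mul_isBigO (isBigO_refl (fun s : ℝ => s ^ 3) _)
    refine (h4.trans_isLittleO h5).congr_left fun s => ?_
    simp only [c]
    ring

/-! ### Low-order terms of the boundary polynomial. -/

namespace SimpleGraph

variable {V : Type*} [Fintype V] (G : SimpleGraph V)

theorem mem_vertexBoundary {S : Finset V} {v : V} :
    v ∈ G.vertexBoundary S ↔ v ∉ S ∧ ∃ u ∈ S, G.Adj u v := by
  simp [vertexBoundary]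

theorem vertexBoundary_empty : G.vertexBoundary ∅ = ∅ := by
  ext v
  simp [mem_vertexBoundary]

open Classical in
theorem boundaryCoeff_eq_sum (i j : ℕ) : (G.boundaryCoeff i j : ℝ) =
    ∑ S : Finset V, if (G.vertexBoundary S).card = i ∧ S.card = j then 1 else 0 := by
  rw [boundaryCoeff, Finset.sum_boole]

theorem boundaryCoeff_zero_zero : G.boundaryCoeff 0 0 = 1 := by
  classical
  rw [boundaryCoeff, Finset.card_eq_one]
  refine ⟨∅, ?_⟩
  ext S
  simp only [Finset.mem_filter, Finset.mem_univ, true_and, Finset.mem_singleton,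
    Finset.card_eq_zero]
  refine ⟨fun h => h.2, fun h => ?_⟩
  subst h
  simp [vertexBoundary_empty]

/-- The rescaled part of degree at least `4` of the boundary polynomial. -/
noncomputable def boundaryPolyTail (z : ℝ × ℝ × ℝ) : ℝ :=
  ∑ S : Finset V, if 4 ≤ (G.vertexBoundary S).card + S.card then
    z.1 ^ ((G.vertexBoundary S).card + S.card - 4) *
      (z.2.1 ^ (G.vertexBoundary S).card * z.2.2 ^ S.card) else 0

theorem contDiff_boundaryPolyTail {n : WithTop ℕ∞} : ContDiff ℝ n G.boundaryPolyTail := by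
  refine ContDiff.sum fun S _ => ?_
  split_ifs
  · fun_prop
  · exact contDiff_const

variable {G}

theorem vertexBoundary_singleton_nonempty (hG : ∀ v, ¬ G.IsIsolated v) (v : V) :
    (G.vertexBoundary {v}).Nonempty := by
  have := hG v
  simp only [IsIsolated, not_forall, not_not] at this
  obtain ⟨w, hw⟩ := this
  exact ⟨w, by simpa [mem_vertexBoundary] using ⟨hw.ne', hw⟩⟩

/-- The third order expansion at the origin of the boundary polynomial of a graph without isolated
vertices. -/
theorem boundaryPoly_mul (hG : ∀ v, ¬ G.IsIsolated v) (s x y : ℝ) :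
    G.boundaryPoly (s * x) (s * y) = 1
      + s ^ 2 * (G.boundaryCoeff 1 1 * x * y + G.boundaryCoeff 0 2 * y ^ 2)
      + s ^ 3 * (G.boundaryCoeff 2 1 * x ^ 2 * y + G.boundaryCoeff 1 2 * x * y ^ 2
        + G.boundaryCoeff 0 3 * y ^ 3)
      + s ^ 4 * G.boundaryPolyTail (s, x, y) := by
  classical
  have h1 : (1 : ℝ) = G.boundaryCoeff 0 0 := by rw [boundaryCoeff_zero_zero, Nat.cast_one]
  rw [h1]
  simp only [boundaryCoeff_eq_sum, boundaryPolyTail, boundaryPoly, Finset.mul_sum, Finset.sum_mul,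
    ← Finset.sum_add_distrib]
  refine Finset.sum_congr rfl fun S _ => ?_
  have h0 : S.card = 0 → (G.vertexBoundary S).card = 0 := fun h => by
    rw [Finset.card_eq_zero] at h ⊢
    rw [h, vertexBoundary_empty]
  -- This excludes the monomial $y$, which would change the linear part of the system.
  have h01 : S.card = 1 → (G.vertexBoundary S).card ≠ 0 := fun h => by
    obtain ⟨v, rfl⟩ := Finset.card_eq_one.1 h
    exact Finset.card_ne_zero.2 (vertexBoundary_singleton_nonempty hG v)
  clear h1
  generalize (G.vertexBoundary S).card = i at *
  generalize S.card = j at *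
  by_cases h4 : 4 ≤ i + j
  · obtain ⟨k, hk⟩ := Nat.exists_eq_add_of_le h4
    have e : s ^ i * s ^ j = s ^ 4 * s ^ (i + j - 4) := by
      rw [← pow_add, ← pow_add, Nat.add_sub_cancel' h4]
    rw [if_neg (by omega), if_neg (by omega), if_neg (by omega), if_neg (by omega),
      if_neg (by omega), if_neg (by omega), if_pos h4, mul_pow, mul_pow]
    linear_combination x ^ i * y ^ j * e
  · have hi : i ≤ 3 := by omega
    have hj : j ≤ 3 := by omega
    interval_cases j <;> interval_cases i <;> simp_all <;> ring

theorem boundaryCoeff_one_one_eq_zero [DecidableRel G.Adj] (h : ∀ v, G.degree v ≠ 1) :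
    G.boundaryCoeff 1 1 = 0 := by
  classical
  rw [boundaryCoeff, Finset.card_eq_zero, Finset.filter_eq_empty_iff]
  rintro S - ⟨h1, h2⟩
  obtain ⟨v, rfl⟩ := Finset.card_eq_one.1 h2
  refine h v ?_
  rw [← h1, ← card_neighborFinset_eq_degree]
  congr 1
  ext w
  simp only [mem_vertexBoundary, mem_neighborFinset, Finset.mem_singleton, exists_eq_left]
  exact ⟨fun h => ⟨h.ne', h⟩, fun h => h.2⟩

/-- A pair of vertices with empty boundary in a graph without isolated vertices spans a connected
component isomorphic to the path on two vertices. -/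
theorem boundaryCoeff_zero_two_eq_zero (hG : ∀ v, ¬ G.IsIsolated v)
    (h : ∀ C : G.ConnectedComponent, IsEmpty (C.toSimpleGraph ≃g pathGraph 2)) :
    G.boundaryCoeff 0 2 = 0 := by
  classical
  rw [boundaryCoeff, Finset.card_eq_zero, Finset.filter_eq_empty_iff]
  rintro S - ⟨h1, h2⟩
  obtain ⟨u, v, huv, rfl⟩ := Finset.card_eq_two.1 h2
  rw [Finset.card_eq_zero] at h1
  -- An empty boundary means that no edge leaves the pair.
  have hclosed : ∀ a ∈ ({u, v} : Finset V), ∀ b, G.Adj a b → b ∈ ({u, v} : Finset V) := by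
    intro a ha b hab
    by_contra hb
    have : b ∈ G.vertexBoundary {u, v} := (G.mem_vertexBoundary).2 ⟨hb, a, ha, hab⟩
    simp [h1] at this
  have hadj : G.Adj u v := by
    have := hG u
    simp only [IsIsolated, not_forall, not_not] at this
    obtain ⟨w, hw⟩ := this
    have := hclosed u (by simp) w hw
    simp only [Finset.mem_insert, Finset.mem_singleton] at this
    rcases this with rfl | rfl
    · exact absurd hw G.irrefl
    · exact hw
  have hreach : ∀ w, G.Reachable u w → w = u ∨ w = v := by
    rintro w ⟨p⟩
    have key : ∀ {a b : V}, G.Walk a b → a ∈ ({u, v} : Finset V) → b ∈ ({u, v} : Finset V) := by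
      intro a b p
      induction p with
      | nil => exact id
      | cons hab _ ih => exact fun ha => ih (hclosed _ ha _ hab)
    simpa using key p (by simp)
  have hsupp : ∀ w, w ∈ (G.connectedComponentMk u).supp ↔ w = u ∨ w = v := by
    intro w
    rw [ConnectedComponent.mem_supp_iff, ConnectedComponent.eq]
    refine ⟨fun hw => hreach w hw.symm, ?_⟩
    rintro (rfl | rfl)
    · exact Reachable.refl _
    · exact hadj.symm.reachable
  refine (h (G.connectedComponentMk u)).elim' ⟨⟨fun w => if w.1 = u then 0 else 1,
    fun i => if i = 0 then ⟨u, (hsupp u).2 (Or.inl rfl)⟩ else ⟨v, (hsupp v).2 (Or.inr rfl)⟩,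
    ?_, ?_⟩, ?_⟩
  · rintro ⟨w, hw⟩
    rcases (hsupp w).1 hw with rfl | rfl <;> simp [huv.symm]
  · intro i
    fin_cases i <;> simp [huv.symm]
  · rintro ⟨a, ha⟩ ⟨b, hb⟩
    have htop : pathGraph 2 = ⊤ := pathGraph_two_eq_top
    rcases (hsupp a).1 ha with rfl | rfl <;> rcases (hsupp b).1 hb with rfl | rfl <;>
      simp [htop, huv.symm, ConnectedComponent.toSimpleGraph, hadj, hadj.symm]

end SimpleGraph

/-! ### The boundary system. -/

theorem corollary3p7 {V₁ V₂ : Type*} [Fintype V₁] [Fintype V₂]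
    (G₁ : SimpleGraph V₁) (G₂ : SimpleGraph V₂) [DecidableRel G₂.Adj]
    (hn₁ : 2 ≤ Fintype.card V₁) (hn₂ : 2 ≤ Fintype.card V₂)
    (hG₁ : ∀ v, ¬ G₁.IsIsolated v) (hG₂ : ∀ v, ¬ G₂.IsIsolated v) :
    ∃ σB : ℝ,
      IsLiapunovNumber (boundaryField G₁ G₂ 0) σB ∧
      σB = 3 * Real.pi / 2 *
        (3 * G₂.boundaryCoeff 0 3 + G₁.boundaryCoeff 1 2 + G₂.boundaryCoeff 2 1
          + 2 * G₁.boundaryCoeff 0 2 * G₂.boundaryCoeff 0 2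
          + G₁.boundaryCoeff 1 1 * G₁.boundaryCoeff 0 2
          - G₂.boundaryCoeff 1 1 * G₂.boundaryCoeff 0 2) ∧
      ((∀ v, G₂.degree v ≠ 1) → ¬ σB < 0) ∧
      ((∀ C : G₂.ConnectedComponent, IsEmpty (C.toSimpleGraph ≃g SimpleGraph.pathGraph 2)) →
        ¬ σB < 0) ∧
      (G₂ = ⊤ → 3 ≤ Fintype.card V₂ → ¬ σB < 0) := by

  -- The zeros are the coefficients of $x^2$ and $x^3$: only $S=\emptyset$ contributes no factor
  -- $y$, and its boundary is empty.
  have hL : IsLiapunovNumber (boundaryField G₁ G₂ 0) _ :=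
    isLiapunovNumber_of_expansion G₁.contDiff_boundaryPolyTail G₂.contDiff_boundaryPolyTail
    0 (G₁.boundaryCoeff 1 1) (G₁.boundaryCoeff 0 2)
    0 (G₁.boundaryCoeff 2 1) (G₁.boundaryCoeff 1 2) (G₁.boundaryCoeff 0 3)
    0 (G₂.boundaryCoeff 1 1) (G₂.boundaryCoeff 0 2)
    0 (G₂.boundaryCoeff 2 1) (G₂.boundaryCoeff 1 2) (G₂.boundaryCoeff 0 3) fun s x y => by
      simp only [boundaryField, SimpleGraph.boundaryPoly_mul hG₁, SimpleGraph.boundaryPoly_mul hG₂]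
      ext <;> ring
  have hpend : (∀ v, G₂.degree v ≠ 1) → ¬ 3 * Real.pi / 2 *
      (3 * (0 + (G₂.boundaryCoeff 0 3 : ℝ)) + G₁.boundaryCoeff 1 2 + G₂.boundaryCoeff 2 1
        + G₁.boundaryCoeff 1 1 * (0 + G₁.boundaryCoeff 0 2)
        - G₂.boundaryCoeff 1 1 * (0 + G₂.boundaryCoeff 0 2) - 2 * 0 * 0
        + 2 * G₁.boundaryCoeff 0 2 * G₂.boundaryCoeff 0 2) < 0 := fun h => by
    refine not_lt.2 (mul_nonneg (by positivity : 0 ≤ 3 * Real.pi / 2) ?_)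
    rw [SimpleGraph.boundaryCoeff_one_one_eq_zero h]
    simp only [Nat.cast_zero, zero_add, mul_zero, zero_mul, sub_zero]
    positivity
  refine ⟨_, hL, by ring, hpend, fun h => ?_, fun h h3 => hpend fun v => ?_⟩
  · rw [SimpleGraph.boundaryCoeff_zero_two_eq_zero hG₂ h, not_lt]
    refine mul_nonneg (by positivity) ?_
    simp only [Nat.cast_zero, zero_add, mul_zero, sub_zero, add_zero]
    positivity
  · classical
    have hv : G₂.degree v = Fintype.card V₂ - 1 := by
      subst h
      convert SimpleGraph.complete_graph_degree v
    omega
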